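/- Let $X$ be a compact Hausdorff space, $\mu$ a regular Borel probability measure on $X$, and $\varphi\colon X\to X$ a Borel map. Assume that $\mu$ is $\varphi$-bounded, i.e. there is $K>0$ with $\mu(\varphi(E))\le K\mu(E)$ for all measurable $E\subseteq X$ ($\mu(\varphi(E))$ being read as outer measure if $\varphi(E)$ is not measurable), and that $C_\varphi\xi=\xi\circ\varphi$ defines a bounded operator on $L^2(X,\mu)$ which is bounded below: $c_0\|\xi\|_2\le\|C_\varphi\xi\|_2\le c_1\|\xi\|_2$ for all $\xi\in L^2(X,\mu)$, with constants $c_0,c_1>0$. Identify $f\in L^\infty(X,\mu)$ with the multiplication operator $M_f\in\mathcal B(L^2(X,\mu))$, let $\alpha\colon L^\infty(X,\mu)\to L^\infty(X,\mu)$, $\alpha(f)=f\circ\varphi$, and let $C_\varphi=S_\varphi a_\varphi$ be the polar decomposition, where $a_\varphi=(C_\varphi^*C_\varphi)^{1/2}$ is invertible and $S_\varphi=C_\varphi a_\varphi^{-1}$ is an isometry. Consider the following two modules with $L^\infty(X,\mu)$-valued inner product over $L^\infty(X,\mu)$. - $L^\infty(X,\mu)_{\mathcal L}$ is the vector space $L^\infty(X,\mu)$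 with $\xi\cdot a=\xi\,\alpha(a)$ and $\langle\eta,\xi\rangle_{\mathcal L}=\mathcal L(\eta^*\xi)$, where $\mathcal L(a)=S_\varphi^*aS_\varphi\in L^\infty(X,\mu)$. - $\mathcal E(X,\mu)=\{T\in\mathcal B(L^2(X,\mu)) : Ta=\alpha(a)T \text{ for all } a\in L^\infty(X,\mu)\}$ with $T\cdot a=Ta$ and $\langle S,T\rangle=S^*T\in L^\infty(X,\mu)$. A finite family $\{e_i\}_{i=1}^n$ in such a module is an orthonormal basis if $\langle e_i,e_j\rangle=\delta_{ij}1$ for all $i,j$ and $x=\sum_{i=1}^n e_i\cdot\langle e_i,x\rangle$ for every element $x$ of the module. For every $n\in\mathbb N$ and all $\xi_1,\dots,\xi_n\in L^\infty(X,\mu)$ the following are equivalent: 1. $\{\xi_i\}_{i=1}^n$ is an orthonormal basis of $L^\infty(X,\mu)_{\mathcal L}$; 2. $\{\xi_iS_\varphi\}_{i=1}^n$ (which lies in $\mathcal E(X,\mu)$) is an orthonormal basis of $\mathcal E(X,\mu)$; 3. $S_i:=\xi_iS_\varphi$, $i=1,\dots,n$, is a Cuntz family, i.e. $S_i^*S_j=\delta_{ij}I$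 for all $i,j$ and $\sum_{i=1}^nS_iS_i^*=I$, and it implements $\alpha$, i.e. $\alpha(a)=\sum_{i=1}^nS_iaS_i^*$ for all $a\in L^\infty(X,\mu)$. -/

import Mathlib

open MeasureTheory
open scoped ENNReal NNReal

noncomputable section

namespace CuntzModule

/-! ### Operators on a Hilbert space -/

section Hilbert

variable {H : Type*} [NormedAddCommGroup H] [InnerProductSpace ℂ H] [CompleteSpace H]

lemma norm_eq_sqrt_norm_star_mul_self (T : H →L[ℂ] H) : ‖T‖ = √‖star T * T‖ := by
  rw [CStarRing.norm_star_mul_self, Real.sqrt_mul_self (norm_nonneg _)]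

/-- `T` is bounded below. -/
def BoundedBelow (T : H →L[ℂ] H) : Prop :=
  ∃ c : ℝ, 0 < c ∧ ∀ x : H, c * ‖x‖ ≤ ‖T x‖

/-- The positive part `|T| = (T* T)^(1/2)` of the polar decomposition of `T`. -/
def polarAbs (T : H →L[ℂ] H) : H →L[ℂ] H := CFC.abs T

/-- The isometric factor `T |T|⁻¹` of the polar decomposition `T = S |T|` of an operator `T`
that is bounded below (so that `|T|` is invertible). -/
def polarPart (T : H →L[ℂ] H) : H →L[ℂ] H := T * Ring.inverse (polarAbs T)

lemma polarAbs_mul_self (T : H →L[ℂ] H) : polarAbs T * polarAbs T = star T * T :=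
  CFC.abs_mul_abs T

lemma isSelfAdjoint_polarAbs (T : H →L[ℂ] H) : star (polarAbs T) = polarAbs T :=
  (CFC.abs_nonneg T).isSelfAdjoint

lemma BoundedBelow.isUnit_polarAbs {T : H →L[ℂ] H} (hT : BoundedBelow T) :
    IsUnit (polarAbs T) := by
  obtain ⟨c, hc, h⟩ := hT
  have h1 : (algebraMap ℝ (H →L[ℂ] H) (c ^ 2)) ≤ star T * T := by
    rw [ContinuousLinearMap.le_def, ContinuousLinearMap.isPositive_def']
    constructor
    · exact (IsSelfAdjoint.star_mul_self T).sub (IsSelfAdjoint.algebraMap _ (IsSelfAdjoint.all _))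
    · intro x
      have e1 : (star T * T).reApplyInnerSelf x = ‖T x‖ ^ 2 := by
        rw [ContinuousLinearMap.apply_norm_sq_eq_inner_adjoint_left]; rfl
      have e2 : (algebraMap ℝ (H →L[ℂ] H) (c ^ 2)).reApplyInnerSelf x = c ^ 2 * ‖x‖ ^ 2 := by
        rw [ContinuousLinearMap.reApplyInnerSelf_apply, Algebra.algebraMap_eq_smul_one]
        simp [inner_smul_left_eq_smul, inner_self_eq_norm_sq_to_K, ← Complex.ofReal_pow]
      have : (star T * T - algebraMap ℝ (H →L[ℂ] H) (c ^ 2)).reApplyInnerSelf x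
          = ‖T x‖ ^ 2 - c ^ 2 * ‖x‖ ^ 2 := by
        rw [← e1, ← e2]
        simp [ContinuousLinearMap.reApplyInnerSelf_apply, inner_sub_left]
      rw [this]
      have := h x
      have h3 : (c * ‖x‖) ^ 2 ≤ ‖T x‖ ^ 2 := by gcongr
      nlinarith
  have h2 : IsStrictlyPositive (algebraMap ℝ (H →L[ℂ] H) (c ^ 2)) := by
    refine IsUnit.isStrictlyPositive ?_ ?_
    · exact (isUnit_iff_ne_zero.mpr (by positivity)).map _
    · exact algebraMap_nonneg _ (by positivity)
  have h3 := CStarAlgebra.isUnit_of_le _ h1 h2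
  rw [← polarAbs_mul_self, (Commute.refl _).isUnit_mul_iff] at h3
  exact h3.1

lemma BoundedBelow.polarPart_mul_polarAbs {T : H →L[ℂ] H} (hT : BoundedBelow T) :
    polarPart T * polarAbs T = T := by
  rw [polarPart, mul_assoc, Ring.inverse_mul_cancel _ hT.isUnit_polarAbs, mul_one]

lemma star_ringInverse_polarAbs (T : H →L[ℂ] H) :
    star (Ring.inverse (polarAbs T)) = Ring.inverse (polarAbs T) := by
  rw [← Ring.inverse_star, isSelfAdjoint_polarAbs]

lemma BoundedBelow.star_polarPart_mul_polarPart {T : H →L[ℂ] H} (hT : BoundedBelow T) :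
    star (polarPart T) * polarPart T = 1 := by
  have hu := hT.isUnit_polarAbs
  calc star (polarPart T) * polarPart T
      = Ring.inverse (polarAbs T) * (star T * T) * Ring.inverse (polarAbs T) := by
        rw [polarPart, star_mul, star_ringInverse_polarAbs]; simp only [mul_assoc]
    _ = (Ring.inverse (polarAbs T) * polarAbs T) * (polarAbs T * Ring.inverse (polarAbs T)) := by
        rw [← polarAbs_mul_self]; simp only [mul_assoc]
    _ = 1 := by rw [Ring.inverse_mul_cancel _ hu, Ring.mul_inverse_cancel _ hu, one_mul]

lemma commute_ringInverse {M : Type*} [MonoidWithZero M] {a b : M} (h : Commute a b) :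
    Commute (Ring.inverse a) b := by
  by_cases ha : IsUnit a
  · obtain ⟨u, rfl⟩ := ha
    rw [Ring.inverse_unit]
    exact h.units_inv_left
  · rw [Ring.inverse_non_unit _ ha]
    exact Commute.zero_left _

lemma commute_polarAbs {T a : H →L[ℂ] H} (h : Commute (star T * T) a) :
    Commute (polarAbs T) a :=
  Commute.cfcₙ_nnreal h _

/-- A finite Cuntz family: isometries with pairwise orthogonal ranges whose range projections
add up to the identity. -/
def IsCuntzFamily {n : ℕ} (S : Fin n → H →L[ℂ] H) : Prop :=
  (∀ i j, star (S i) * S j = if i = j then 1 else 0) ∧ ∑ i, S i * star (S i) = 1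

end Hilbert

/-! ### Orthonormal bases of Hilbert modules -/

/-- A finite orthonormal basis of a Hilbert module `E` over `A`:
`⟪e i, e j⟫ = δ i j` and `x = ∑ i, e i · ⟪e i, x⟫` for all `x`. (In Mathlib's `CStarModule`, the
right action of `a` on `x` is written `a • x`.) -/
def IsOrthonormalModuleBasis (A : Type*) {E : Type*} [Ring A] [StarRing A] [Module ℂ A]
    [AddCommGroup E] [Module ℂ E] [PartialOrder A] [SMul A E] [Norm A] [Norm E]
    [CStarModule A E] {n : ℕ} (e : Fin n → E) : Prop :=
  (∀ i j, inner A (e i) (e j) = if i = j then 1 else 0) ∧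
    ∀ x : E, x = ∑ i, inner A (e i) x • e i

/-! ### `L^∞` as multiplication operators on `L²` -/

section Linfty

variable {X : Type*} [MeasurableSpace X] (μ : Measure X)

/-- Bounded operators on `L²(X, μ)`. -/
abbrev BL2 : Type _ := Lp ℂ 2 μ →L[ℂ] Lp ℂ 2 μ

variable {μ}

/-- The multiplication operator `M_f` on `L²` with symbol `f ∈ L^∞`. -/
def mulOp (f : Lp ℂ ∞ μ) : BL2 μ := (ContinuousLinearMap.mul ℂ ℂ).holderL μ ∞ 2 2 f

lemma coeFn_mulOp (f : Lp ℂ ∞ μ) (g : Lp ℂ 2 μ) : mulOp f g =ᵐ[μ] fun x => f x * g x :=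
  (ContinuousLinearMap.mul ℂ ℂ).coeFn_holder f g

/-- The product of two elements of `L^∞`. -/
def linfMul (f g : Lp ℂ ∞ μ) : Lp ℂ ∞ μ := (ContinuousLinearMap.mul ℂ ℂ).holder ∞ f g

lemma coeFn_linfMul (f g : Lp ℂ ∞ μ) : linfMul f g =ᵐ[μ] fun x => f x * g x :=
  (ContinuousLinearMap.mul ℂ ℂ).coeFn_holder f g

lemma mulOp_add (f g : Lp ℂ ∞ μ) : mulOp (f + g) = mulOp f + mulOp g := map_add _ f g

lemma mulOp_smul (c : ℂ) (f : Lp ℂ ∞ μ) : mulOp (c • f) = c • mulOp f := map_smul _ c f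

lemma mulOp_mul (f g : Lp ℂ ∞ μ) : mulOp (linfMul f g) = mulOp f * mulOp g := by
  ext1 h
  refine Lp.ext ?_
  rw [mul_apply_eq_comp]
  filter_upwards [coeFn_mulOp (linfMul f g) h, coeFn_linfMul f g, coeFn_mulOp g h,
    coeFn_mulOp f (mulOp g h)] with x h1 h2 h3 h4
  rw [h1, h2, h4, h3, mul_assoc]

lemma mulOp_star (f : Lp ℂ ∞ μ) : star (mulOp f) = mulOp (star f) := by
  rw [ContinuousLinearMap.star_eq_adjoint, eq_comm, ContinuousLinearMap.eq_adjoint_iff]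
  intro g h
  rw [L2.inner_def, L2.inner_def]
  refine integral_congr_ae ?_
  filter_upwards [coeFn_mulOp (star f) g, coeFn_mulOp f h, Lp.coeFn_star f] with x h1 h2 h3
  rw [h1, h2, h3]
  simp only [RCLike.inner_apply, map_mul, Pi.star_apply, RCLike.star_def, RingHomCompTriple.comp_apply,
    RingHom.id_apply]
  ring

variable [IsFiniteMeasure μ]

lemma mulOp_const (c : ℂ) : mulOp (Lp.const ∞ μ c) = algebraMap ℂ (BL2 μ) c := by
  ext1 h
  refine Lp.ext ?_
  rw [Algebra.algebraMap_eq_smul_one]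
  filter_upwards [coeFn_mulOp (Lp.const ∞ μ c) h, Lp.coeFn_const ∞ μ c,
    Lp.coeFn_smul c h] with x h1 h2 h3
  rw [h1, h2, smul_apply, one_apply_eq_self, h3]
  rfl

lemma coeFn_mulOp_one (f : Lp ℂ ∞ μ) : mulOp f (Lp.const 2 μ 1) =ᵐ[μ] f := by
  filter_upwards [coeFn_mulOp f (Lp.const 2 μ 1), Lp.coeFn_const 2 μ (1 : ℂ)] with x h1 h2
  rw [h1, h2]
  simp

/-- The constant function `1` is separating for `L^∞`. -/
lemma mulOp_injective : Function.Injective (mulOp : Lp ℂ ∞ μ → BL2 μ) := by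
  intro f g h
  refine Lp.ext ?_
  filter_upwards [coeFn_mulOp_one f, coeFn_mulOp_one g] with x h1 h2
  rw [← h1, ← h2, h]

variable (μ)

/-- `L^∞(X, μ)`, identified with the algebra of multiplication operators `M_f` on `L²(X, μ)`. -/
def LInf : StarSubalgebra ℂ (BL2 μ) where
  carrier := Set.range mulOp
  mul_mem' := by
    rintro _ _ ⟨f, rfl⟩ ⟨g, rfl⟩
    exact ⟨_, mulOp_mul f g⟩
  add_mem' := by
    rintro _ _ ⟨f, rfl⟩ ⟨g, rfl⟩
    exact ⟨_, mulOp_add f g⟩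
  algebraMap_mem' c := ⟨_, mulOp_const c⟩
  star_mem' := by
    rintro _ ⟨f, rfl⟩
    exact ⟨_, (mulOp_star f).symm⟩

variable {μ}

lemma mem_LInf {T : BL2 μ} : T ∈ LInf μ ↔ ∃ f, mulOp f = T := Iff.rfl

/-- The multiplication operator `M_f` as an element of `LInf μ`. -/
def ofLinf (f : Lp ℂ ∞ μ) : LInf μ := ⟨mulOp f, f, rfl⟩

/-- The function `f ∈ L^∞` with `a = M_f`. -/
def symbol (a : LInf μ) : Lp ℂ ∞ μ := a.2.choose

@[simp] lemma mulOp_symbol (a : LInf μ) : mulOp (symbol a) = a := a.2.choose_spec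

@[simp] lemma coe_ofLinf (f : Lp ℂ ∞ μ) : (ofLinf f : BL2 μ) = mulOp f := rfl

@[simp] lemma ofLinf_symbol (a : LInf μ) : ofLinf (symbol a) = a :=
  Subtype.ext (mulOp_symbol a)

@[simp] lemma symbol_ofLinf (f : Lp ℂ ∞ μ) : symbol (ofLinf f) = f :=
  mulOp_injective (mulOp_symbol (ofLinf f))

lemma ofLinf_add (f g : Lp ℂ ∞ μ) : ofLinf (f + g) = ofLinf f + ofLinf g :=
  Subtype.ext (mulOp_add f g)

lemma ofLinf_mul (f g : Lp ℂ ∞ μ) : ofLinf (linfMul f g) = ofLinf f * ofLinf g :=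
  Subtype.ext (mulOp_mul f g)

lemma ofLinf_star (f : Lp ℂ ∞ μ) : ofLinf (star f) = star (ofLinf f) :=
  Subtype.ext (mulOp_star f).symm

lemma ofLinf_const (c : ℂ) : ofLinf (Lp.const ∞ μ c) = algebraMap ℂ (LInf μ) c :=
  Subtype.ext (mulOp_const c)

lemma LInf_mul_comm (a b : LInf μ) : a * b = b * a := by
  obtain ⟨f, rfl⟩ : ∃ f, ofLinf f = a := ⟨_, ofLinf_symbol a⟩
  obtain ⟨g, rfl⟩ : ∃ g, ofLinf g = b := ⟨_, ofLinf_symbol b⟩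
  rw [← ofLinf_mul, ← ofLinf_mul]
  congr 1
  refine Lp.ext ?_
  filter_upwards [coeFn_linfMul f g, coeFn_linfMul g f] with x h1 h2
  rw [h1, h2, mul_comm]

lemma LInf_coe_mul_comm (a b : LInf μ) : (a : BL2 μ) * b = b * a :=
  congrArg Subtype.val (LInf_mul_comm a b)

/-- `L^∞` is its own commutant: it is a maximal abelian self-adjoint algebra. -/
lemma mem_LInf_of_commute {T : BL2 μ} (hT : ∀ a : LInf μ, T * a = a * T) : T ∈ LInf μ := by
  set g : Lp ℂ 2 μ := T (Lp.const 2 μ 1) with hg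
  have key : ∀ f : Lp ℂ ∞ μ, T (mulOp f (Lp.const 2 μ 1)) = mulOp f g := by
    intro f
    have := congrArg (fun R : BL2 μ => R (Lp.const 2 μ 1)) (hT (ofLinf f))
    simpa using this
  have ind : ∀ {s : Set X} (hs : MeasurableSet s) (c : ℂ),
      mulOp (indicatorConstLp ∞ hs (measure_ne_top μ s) c) (Lp.const 2 μ 1)
        = indicatorConstLp 2 hs (measure_ne_top μ s) c := by
    intro s hs c
    refine Lp.ext ?_
    filter_upwards [coeFn_mulOp_one (indicatorConstLp ∞ hs (measure_ne_top μ s) c),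
      indicatorConstLp_coeFn (p := ∞) (hs := hs) (hμs := measure_ne_top μ s) (c := c),
      indicatorConstLp_coeFn (p := 2) (hs := hs) (hμs := measure_ne_top μ s) (c := c)]
      with x h1 h2 h3
    rw [h1, h2, h3]
  have hbound : ∀ᵐ x ∂μ, ‖g x‖ ≤ ‖T‖ := by
    have hle : (fun x => ‖g x‖ₑ ^ 2) ≤ᵐ[μ] fun _ => ‖T‖ₑ ^ 2 := by
      refine ae_le_of_forall_setLIntegral_le_of_sigmaFinite
        ((Lp.stronglyMeasurable g).enorm.pow_const 2) ?_
      intro s hs _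
      have h1 : ‖T (indicatorConstLp 2 hs (measure_ne_top μ s) (1 : ℂ))‖ₑ ^ 2
          ≤ (‖T‖ₑ * ‖indicatorConstLp 2 hs (measure_ne_top μ s) (1 : ℂ)‖ₑ) ^ 2 := by
        gcongr
        exact ContinuousLinearMap.le_opENorm _ _
      rw [← ind hs 1, key, ind hs 1, mul_pow] at h1
      have sq : ∀ f : Lp ℂ 2 μ, ‖f‖ₑ ^ 2 = ∫⁻ x, ‖f x‖ₑ ^ 2 ∂μ := by
        intro f
        rw [Lp.enorm_def, eLpNorm_eq_lintegral_rpow_enorm_toReal two_ne_zero ENNReal.ofNat_ne_top]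
        rw [← ENNReal.rpow_natCast, ← ENNReal.rpow_mul]
        simp
      rw [sq, sq] at h1
      have e1 : ∫⁻ x, ‖mulOp (indicatorConstLp ∞ hs (measure_ne_top μ s) (1 : ℂ)) g x‖ₑ ^ 2 ∂μ
          = ∫⁻ x in s, ‖g x‖ₑ ^ 2 ∂μ := by
        rw [← lintegral_indicator hs]
        refine lintegral_congr_ae ?_
        filter_upwards [coeFn_mulOp (indicatorConstLp ∞ hs (measure_ne_top μ s) (1 : ℂ)) g,
          indicatorConstLp_coeFn (p := ∞) (hs := hs) (hμs := measure_ne_top μ s) (c := (1 : ℂ))]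
          with x h1 h2
        rw [h1, h2]
        by_cases hx : x ∈ s <;> simp [hx]
      have e2 : ∫⁻ x, ‖indicatorConstLp 2 hs (measure_ne_top μ s) (1 : ℂ) x‖ₑ ^ 2 ∂μ = μ s := by
        rw [← lintegral_indicator_one hs]
        refine lintegral_congr_ae ?_
        filter_upwards [
          indicatorConstLp_coeFn (p := 2) (hs := hs) (hμs := measure_ne_top μ s) (c := (1 : ℂ))]
          with x h2
        rw [h2]
        by_cases hx : x ∈ s <;> simp [hx]
      rw [e1, e2] at h1
      simpa using h1
    filter_upwards [hle] with x hx
    have hx' : ‖g x‖ₑ ≤ ‖T‖ₑ := by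
      by_contra hcon
      exact absurd hx (not_le.mpr (ENNReal.pow_lt_pow_left two_ne_zero (not_le.mp hcon)))
    exact enorm_le_iff_norm_le.mp hx'
  have hmem : MemLp g ∞ μ := memLp_top_of_bound (Lp.aestronglyMeasurable g) _ hbound
  refine ⟨hmem.toLp, ?_⟩
  ext1 ξ
  have swap : ∀ f : Lp ℂ ∞ μ, mulOp f g = mulOp (hmem.toLp) (mulOp f (Lp.const 2 μ 1)) := by
    intro f
    refine Lp.ext ?_
    filter_upwards [coeFn_mulOp f g, coeFn_mulOp (hmem.toLp) (mulOp f (Lp.const 2 μ 1)),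
      coeFn_mulOp_one f, hmem.coeFn_toLp] with x h1 h2 h3 h4
    rw [h1, h2, h3, h4, mul_comm]
  refine Lp.induction ENNReal.ofNat_ne_top
    (fun ξ : Lp ℂ 2 μ => mulOp hmem.toLp ξ = T ξ) ?_ ?_ ?_ ξ
  · intro c s hs hμs
    rw [Lp.simpleFunc.coe_indicatorConst, ← ind hs c, key, swap]
  · intro f g hf hg _ h1 h2
    simp only [map_add, h1, h2]
  · exact isClosed_eq (ContinuousLinearMap.continuous _) T.continuous

end Linfty

/-! ### The intertwining module -/

section Intertwining

variable {X : Type*} [MeasurableSpace X] {μ : Measure X} [IsFiniteMeasure μ]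

/-- The intertwining module `E(X, μ) = {T ∈ B(L²) | T a = α(a) T for all a ∈ L^∞}`. -/
def intertwiningModule (α : LInf μ →⋆ₐ[ℂ] LInf μ) : Submodule ℂ (BL2 μ) where
  carrier := {T | ∀ a : LInf μ, T * a = α a * T}
  add_mem' := by
    intro S T hS hT a
    rw [add_mul, mul_add, hS a, hT a]
  zero_mem' := by
    intro a
    rw [zero_mul, mul_zero]
  smul_mem' := by
    intro c T hT a
    rw [smul_mul_assoc, mul_smul_comm, hT a]

variable {α : LInf μ →⋆ₐ[ℂ] LInf μ}

lemma mem_intertwiningModule {T : BL2 μ} :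
    T ∈ intertwiningModule α ↔ ∀ a : LInf μ, T * a = α a * T := Iff.rfl

lemma star_mul_intertwiner {T : BL2 μ} (hT : T ∈ intertwiningModule α) (a : LInf μ) :
    star T * α a = a * star T := by
  have h := congrArg star (hT (star a))
  rw [star_mul, star_mul, map_star] at h
  simpa using h.symm

/-- If `S, T` intertwine then `S* b T` lies in `L^∞` for all `b ∈ L^∞`. -/
lemma star_mul_mul_mem_LInf {S T : BL2 μ} (hS : S ∈ intertwiningModule α)
    (hT : T ∈ intertwiningModule α) (b : LInf μ) : star S * b * T ∈ LInf μ := by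
  refine mem_LInf_of_commute fun a => ?_
  calc star S * b * T * a = star S * (b * (T * a)) := by simp only [mul_assoc]
    _ = star S * ((b * α a) * T) := by rw [hT a]; simp only [mul_assoc]
    _ = (star S * α a) * (b * T) := by rw [LInf_coe_mul_comm]; simp only [mul_assoc]
    _ = a * (star S * b * T) := by rw [star_mul_intertwiner hS]; simp only [mul_assoc]

lemma star_mul_mem_LInf {S T : BL2 μ} (hS : S ∈ intertwiningModule α)
    (hT : T ∈ intertwiningModule α) : star S * T ∈ LInf μ := by
  simpa using star_mul_mul_mem_LInf hS hT 1

lemma mul_mem_intertwiningModule {S : BL2 μ} (hS : S ∈ intertwiningModule α) (a : LInf μ) :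
    S * a ∈ intertwiningModule α := by
  intro b
  rw [mul_assoc, LInf_coe_mul_comm, ← mul_assoc, hS b, mul_assoc]

lemma LInf_mul_mem_intertwiningModule {S : BL2 μ} (hS : S ∈ intertwiningModule α)
    (a : LInf μ) : a * S ∈ intertwiningModule α := by
  intro b
  rw [mul_assoc, hS b, ← mul_assoc, LInf_coe_mul_comm, mul_assoc]

/-- The right action `S · a = S a` of `L^∞` on the intertwining module. -/
instance instSMulIntertwining : SMul (LInf μ) (intertwiningModule α) where
  smul a S := ⟨S * a, mul_mem_intertwiningModule S.2 a⟩

lemma coe_smul_intertwining (a : LInf μ) (S : intertwiningModule α) :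
    ((a • S : intertwiningModule α) : BL2 μ) = S * a := rfl

/-- The intertwining module is a Hilbert module over `L^∞` with inner product `⟪S, T⟫ = S* T`;
the resulting norm is the operator norm. -/
instance instCStarModuleIntertwining : CStarModule (LInf μ) (intertwiningModule α) where
  inner S T := ⟨star (S : BL2 μ) * T, star_mul_mem_LInf S.2 T.2⟩
  inner_add_right := by
    intro S T U
    exact Subtype.ext (mul_add _ _ _)
  inner_self_nonneg := by
    intro S
    exact star_mul_self_nonneg (S : BL2 μ)
  inner_self := by
    intro S
    rw [Subtype.ext_iff, Subtype.ext_iff]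
    exact CStarRing.star_mul_self_eq_zero_iff (S : BL2 μ)
  inner_op_smul_right := by
    intro a S T
    refine Subtype.ext ?_
    change star (S : BL2 μ) * (T * a) = a * (star (S : BL2 μ) * T)
    rw [← mul_assoc]
    exact LInf_coe_mul_comm ⟨_, star_mul_mem_LInf S.2 T.2⟩ a
  inner_smul_right_complex := by
    intro z S T
    exact Subtype.ext (mul_smul_comm z _ _)
  star_inner := by
    intro S T
    refine Subtype.ext ?_
    change star (star (S : BL2 μ) * T) = star (T : BL2 μ) * S
    rw [star_mul, star_star]
  norm_eq_sqrt_norm_inner_self := by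
    intro S
    exact norm_eq_sqrt_norm_star_mul_self (S : BL2 μ)

lemma coe_inner_intertwining (S T : intertwiningModule α) :
    ((inner (LInf μ) S T : LInf μ) : BL2 μ) = star (S : BL2 μ) * T := rfl

/-- A finite family `S` of operators on `L²` implements `α` on `L^∞`:
`α(a) = ∑ i, S i a (S i)*` for all `a ∈ L^∞`. -/
def Implements {n : ℕ} (S : Fin n → BL2 μ) (α : LInf μ →⋆ₐ[ℂ] LInf μ) : Prop :=
  ∀ a : LInf μ, (α a : BL2 μ) = ∑ i, S i * a * star (S i)

end Intertwining

/-! ### Composition operators -/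

section Composition

variable {X : Type*} [MeasurableSpace X]

/-- `μ` is `φ`-bounded: there is `K > 0` with `μ(φ(E)) ≤ K μ(E)` for all measurable `E`. -/
def IsPhiBounded (μ : Measure X) (φ : X → X) : Prop :=
  ∃ K : ℝ≥0, 0 < K ∧ ∀ E : Set X, MeasurableSet E → μ (φ '' E) ≤ K * μ E

/-- `φ` is measurable and `f ↦ f ∘ φ` is bounded for the `L²`-norm, that is, it defines a bounded
composition operator on `L²(X, μ)`. -/
structure BoundedComposition (μ : Measure X) (φ : X → X) : Prop where
  measurable : Measurable φ
  exists_bound : ∃ c : ℝ≥0, ∀ f : X → ℂ, MemLp f 2 μ → eLpNorm (f ∘ φ) 2 μ ≤ c * eLpNorm f 2 μ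

variable {μ : Measure X} {φ : X → X}

/-- Then preimages of null sets are null sets. -/
lemma BoundedComposition.quasi (h : BoundedComposition μ φ) :
    Measure.QuasiMeasurePreserving φ μ μ := by
  refine ⟨h.measurable, Measure.AbsolutelyContinuous.mk fun s hs h0 => ?_⟩
  obtain ⟨c, hc⟩ := h.exists_bound
  rw [Measure.map_apply h.measurable hs]
  have hz : s.indicator (fun _ => (1 : ℂ)) =ᵐ[μ] 0 := indicator_meas_zero h0
  have hm : MemLp (s.indicator fun _ => (1 : ℂ)) 2 μ := MemLp.zero.ae_eq hz.symm
  have h1 := hc _ hm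
  rw [eLpNorm_congr_ae hz, eLpNorm_zero, mul_zero, nonpos_iff_eq_zero,
    eLpNorm_eq_zero_iff _ two_ne_zero] at h1
  · have h2 : ∀ᵐ x ∂μ, x ∉ φ ⁻¹' s := by
      filter_upwards [h1] with x hx hxs
      have hxs' : φ x ∈ s := hxs
      simp [hxs'] at hx
    simpa using measure_eq_zero_iff_ae_notMem.mpr h2
  · exact ((measurable_const.indicator hs).comp h.measurable).aestronglyMeasurable

lemma memLp_top_comp (hq : Measure.QuasiMeasurePreserving φ μ μ) (f : Lp ℂ ∞ μ) :
    MemLp (f ∘ φ) ∞ μ :=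
  memLp_top_of_bound ((Lp.aestronglyMeasurable f).comp_quasiMeasurePreserving hq)
    (lpNorm f ∞ μ) (hq.ae (ae_le_lpNorm_exponent_top (Lp.memLp f)))

/-- `f ∘ φ` for `f ∈ L^∞`. -/
def compLinf (hq : Measure.QuasiMeasurePreserving φ μ μ) (f : Lp ℂ ∞ μ) : Lp ℂ ∞ μ :=
  MemLp.toLp (f ∘ φ) (memLp_top_comp hq f)

lemma coeFn_compLinf (hq : Measure.QuasiMeasurePreserving φ μ μ) (f : Lp ℂ ∞ μ) :
    compLinf hq f =ᵐ[μ] f ∘ φ := MemLp.coeFn_toLp (memLp_top_comp hq f)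

lemma memLp_comp (h : BoundedComposition μ φ) (ξ : Lp ℂ 2 μ) : MemLp (ξ ∘ φ) 2 μ := by
  obtain ⟨c, hc⟩ := h.exists_bound
  exact ⟨(Lp.aestronglyMeasurable ξ).comp_quasiMeasurePreserving h.quasi,
    (hc ξ (Lp.memLp ξ)).trans_lt (ENNReal.mul_lt_top ENNReal.coe_lt_top (Lp.memLp ξ).2)⟩

/-- The composition operator `C_φ ξ = ξ ∘ φ` on `L²(X, μ)`. -/
def compOp (h : BoundedComposition μ φ) : BL2 μ :=
  LinearMap.mkContinuousOfExistsBound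
    { toFun := fun ξ => (memLp_comp h ξ).toLp (ξ ∘ φ)
      map_add' := by
        intro ξ η
        rw [← MemLp.toLp_add]
        refine MemLp.toLp_congr _ _ ?_
        filter_upwards [h.quasi.ae (Lp.coeFn_add ξ η)] with x hx
        simpa using hx
      map_smul' := by
        intro z ξ
        rw [RingHom.id_apply, ← MemLp.toLp_const_smul]
        refine MemLp.toLp_congr _ _ ?_
        filter_upwards [h.quasi.ae (Lp.coeFn_smul z ξ)] with x hx
        simpa using hx }
    (by
      obtain ⟨c, hc⟩ := h.exists_bound
      refine ⟨c, fun ξ => ?_⟩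
      have h1 := hc ξ (Lp.memLp ξ)
      change ‖(memLp_comp h ξ).toLp (ξ ∘ φ)‖ ≤ c * ‖ξ‖
      rw [Lp.norm_toLp, Lp.norm_def, ← ENNReal.coe_toReal, ← ENNReal.toReal_mul]
      exact ENNReal.toReal_mono
        (ENNReal.mul_ne_top ENNReal.coe_ne_top (Lp.memLp ξ).2.ne) h1)

lemma coeFn_compOp (h : BoundedComposition μ φ) (ξ : Lp ℂ 2 μ) :
    compOp h ξ =ᵐ[μ] ξ ∘ φ := MemLp.coeFn_toLp (memLp_comp h ξ)

lemma compOp_mul_mulOp (h : BoundedComposition μ φ) (f : Lp ℂ ∞ μ) :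
    compOp h * mulOp f = mulOp (compLinf h.quasi f) * compOp h := by
  ext1 ξ
  refine Lp.ext ?_
  rw [mul_apply_eq_comp, mul_apply_eq_comp]
  filter_upwards [coeFn_compOp h (mulOp f ξ), h.quasi.ae (coeFn_mulOp f ξ),
    coeFn_mulOp (compLinf h.quasi f) (compOp h ξ), coeFn_compLinf h.quasi f, coeFn_compOp h ξ]
    with x h1 h2 h3 h4 h5
  rw [h1, h3, h4, h5, Function.comp_apply, h2]
  rfl

variable [IsFiniteMeasure μ]

lemma compOp_one (h : BoundedComposition μ φ) :
    compOp h (Lp.const 2 μ 1) = Lp.const 2 μ 1 := by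
  refine Lp.ext ?_
  filter_upwards [coeFn_compOp h (Lp.const 2 μ 1), Lp.coeFn_const 2 μ (1 : ℂ),
    h.quasi.ae (Lp.coeFn_const 2 μ (1 : ℂ))] with x h1 h2 h3
  rw [h1, h2, Function.comp_apply, h3]
  rfl

/-- The endomorphism `α : M_f ↦ M_{f ∘ φ}` of `L^∞`. -/
def compEndo (hq : Measure.QuasiMeasurePreserving φ μ μ) : LInf μ →⋆ₐ[ℂ] LInf μ where
  toFun a := ofLinf (compLinf hq (symbol a))
  map_one' := by
    rw [← map_one (algebraMap ℂ (LInf μ)), ← ofLinf_const, symbol_ofLinf]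
    congr 1
    refine Lp.ext ?_
    filter_upwards [coeFn_compLinf hq (Lp.const ∞ μ 1), Lp.coeFn_const ∞ μ (1 : ℂ),
      hq.ae (Lp.coeFn_const ∞ μ (1 : ℂ))] with x h1 h2 h3
    rw [h1, h2, Function.comp_apply, h3]
    rfl
  map_mul' := by
    intro a b
    rw [← ofLinf_mul]
    congr 1
    rw [← ofLinf_symbol a, ← ofLinf_symbol b, ← ofLinf_mul]
    simp only [symbol_ofLinf]
    refine Lp.ext ?_
    filter_upwards [coeFn_compLinf hq (linfMul (symbol a) (symbol b)),
      coeFn_linfMul (compLinf hq (symbol a)) (compLinf hq (symbol b)),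
      hq.ae (coeFn_linfMul (symbol a) (symbol b)), coeFn_compLinf hq (symbol a),
      coeFn_compLinf hq (symbol b)] with x h1 h2 h3 h4 h5
    rw [h1, h2, Function.comp_apply, h3, h4, h5]
    rfl
  map_zero' := by
    rw [← map_zero (algebraMap ℂ (LInf μ)), ← ofLinf_const, symbol_ofLinf]
    congr 1
    refine Lp.ext ?_
    filter_upwards [coeFn_compLinf hq (Lp.const ∞ μ 0), Lp.coeFn_const ∞ μ (0 : ℂ),
      hq.ae (Lp.coeFn_const ∞ μ (0 : ℂ))] with x h1 h2 h3
    rw [h1, h2, Function.comp_apply, h3]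
    rfl
  map_add' := by
    intro a b
    rw [← ofLinf_add]
    congr 1
    rw [← ofLinf_symbol a, ← ofLinf_symbol b, ← ofLinf_add]
    simp only [symbol_ofLinf]
    refine Lp.ext ?_
    filter_upwards [coeFn_compLinf hq (symbol a + symbol b),
      Lp.coeFn_add (compLinf hq (symbol a)) (compLinf hq (symbol b)),
      hq.ae (Lp.coeFn_add (symbol a) (symbol b)), coeFn_compLinf hq (symbol a),
      coeFn_compLinf hq (symbol b)] with x h1 h2 h3 h4 h5
    rw [h1, h2, Function.comp_apply, h3, Pi.add_apply, Pi.add_apply, h4, h5]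
    rfl
  commutes' := by
    intro z
    rw [← ofLinf_const, symbol_ofLinf]
    congr 1
    refine Lp.ext ?_
    filter_upwards [coeFn_compLinf hq (Lp.const ∞ μ z), Lp.coeFn_const ∞ μ z,
      hq.ae (Lp.coeFn_const ∞ μ z)] with x h1 h2 h3
    rw [h1, h2, Function.comp_apply, h3]
    rfl
  map_star' := by
    intro a
    rw [← ofLinf_star]
    congr 1
    rw [← ofLinf_symbol a, ← ofLinf_star]
    simp only [symbol_ofLinf]
    refine Lp.ext ?_
    filter_upwards [coeFn_compLinf hq (star (symbol a)),
      Lp.coeFn_star (compLinf hq (symbol a)),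
      hq.ae (Lp.coeFn_star (symbol a)), coeFn_compLinf hq (symbol a)] with x h1 h2 h3 h4
    rw [h1, h2, Function.comp_apply, h3, Pi.star_apply, Pi.star_apply, h4]
    rfl

lemma compEndo_ofLinf (hq : Measure.QuasiMeasurePreserving φ μ μ) (f : Lp ℂ ∞ μ) :
    compEndo hq (ofLinf f) = ofLinf (compLinf hq f) := by
  change ofLinf (compLinf hq (symbol (ofLinf f))) = _
  rw [symbol_ofLinf]

/-- The endomorphism `α` of `L^∞` given by composition with `φ`. -/
abbrev alpha (h : BoundedComposition μ φ) : LInf μ →⋆ₐ[ℂ] LInf μ := compEndo h.quasi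

lemma compOp_mem (h : BoundedComposition μ φ) : compOp h ∈ intertwiningModule (alpha h) := by
  intro a
  rw [← ofLinf_symbol a, compEndo_ofLinf]
  exact compOp_mul_mulOp h _

/-- The factor `S_φ` of the polar decomposition `C_φ = S_φ a_φ`, `a_φ = |C_φ|`. -/
abbrev polarS (h : BoundedComposition μ φ) : BL2 μ := polarPart (compOp h)

lemma polarS_mem (h : BoundedComposition μ φ) : polarS h ∈ intertwiningModule (alpha h) := by
  intro a
  have h1 : Commute (star (compOp h) * compOp h) (a : BL2 μ) :=
    LInf_coe_mul_comm ⟨_, star_mul_mem_LInf (compOp_mem h) (compOp_mem h)⟩ a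
  have h2 := (commute_ringInverse (commute_polarAbs h1)).eq
  rw [polarS, polarPart, mul_assoc, h2, ← mul_assoc, compOp_mem h a, mul_assoc]

/-- The element `ξ S_φ` of the intertwining module, for `ξ ∈ L^∞`. -/
def mulPolarS (h : BoundedComposition μ φ) (ξ : LInf μ) : intertwiningModule (alpha h) :=
  ⟨ξ * polarS h, LInf_mul_mem_intertwiningModule (polarS_mem h) ξ⟩

/-- The transfer operator `L(a) = S_φ* a S_φ` on `L^∞`. -/
def transferOp (h : BoundedComposition μ φ) : LInf μ →ₗ[ℂ] LInf μ where
  toFun a := ⟨star (polarS h) * a * polarS h,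
    star_mul_mul_mem_LInf (polarS_mem h) (polarS_mem h) a⟩
  map_add' := by
    intro a b
    refine Subtype.ext ?_
    change star (polarS h) * (a + b : BL2 μ) * polarS h = _
    rw [mul_add, add_mul]
    rfl
  map_smul' := by
    intro z a
    refine Subtype.ext ?_
    change star (polarS h) * (z • (a : BL2 μ)) * polarS h = _
    rw [mul_smul_comm, smul_mul_assoc]
    rfl

lemma coe_transferOp (h : BoundedComposition μ φ) (a : LInf μ) :
    (transferOp h a : BL2 μ) = star (polarS h) * a * polarS h := rfl

/-- The Hilbert module `L^∞(X, μ)_L`: its underlying vector space is `L^∞(X, μ)`, and its module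
structure, inner product and norm come from the transfer operator. -/
def TransferModule (h : BoundedComposition μ φ) (_hb : BoundedBelow (compOp h)) : Type _ := LInf μ

variable {h : BoundedComposition μ φ} {hb : BoundedBelow (compOp h)}

instance instAddCommGroupTransfer : AddCommGroup (TransferModule h hb) :=
  inferInstanceAs (AddCommGroup (LInf μ))

instance instModuleTransfer : Module ℂ (TransferModule h hb) :=
  inferInstanceAs (Module ℂ (LInf μ))

variable (h hb) in
/-- An element of `L^∞(X, μ)`, regarded as an element of `L^∞(X, μ)_L`. -/
def toTransfer : LInf μ ≃ₗ[ℂ] TransferModule h hb := LinearEquiv.refl ℂ (LInf μ)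

variable (h hb) in
/-- An element of `L^∞(X, μ)_L`, regarded as an element of `L^∞(X, μ)`. -/
abbrev ofTransfer : TransferModule h hb ≃ₗ[ℂ] LInf μ := (toTransfer h hb).symm

/-- The right action `ξ · a = ξ α(a)` of `L^∞` on `L^∞(X, μ)_L`. -/
instance instSMulTransfer : SMul (LInf μ) (TransferModule h hb) where
  smul a ξ := toTransfer h hb (ofTransfer h hb ξ * alpha h a)

lemma smul_transfer (a : LInf μ) (ξ : TransferModule h hb) :
    a • ξ = toTransfer h hb (ofTransfer h hb ξ * alpha h a) := rfl

/-- The norm `‖ξ‖_L = ‖L(ξ* ξ)‖^(1/2)`. -/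
instance instNormTransfer : Norm (TransferModule h hb) where
  norm ξ := √‖transferOp h (star (ofTransfer h hb ξ) * ofTransfer h hb ξ)‖

lemma eq_zero_of_mul_polarS {h : BoundedComposition μ φ} (hb : BoundedBelow (compOp h))
    {ξ : LInf μ} (hξ : (ξ : BL2 μ) * polarS h = 0) : ξ = 0 := by
  have h1 : (ξ : BL2 μ) * compOp h = 0 := by
    rw [← hb.polarPart_mul_polarAbs, ← mul_assoc, hξ, zero_mul]
  have h2 := congrArg (fun R : BL2 μ => R (Lp.const 2 μ 1)) h1
  simp only [mul_apply_eq_comp, compOp_one] at h2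
  rw [← mulOp_symbol ξ] at h2
  have h3 : symbol ξ = symbol (0 : LInf μ) := by
    have hz : symbol (0 : LInf μ) = 0 := by
      apply mulOp_injective
      rw [mulOp_symbol]
      exact (map_zero ((ContinuousLinearMap.mul ℂ ℂ).holderL μ ∞ 2 2)).symm
    rw [hz]
    refine Lp.ext ?_
    have h4 : mulOp (symbol ξ) (Lp.const 2 μ 1) = 0 := h2
    have h5 := coeFn_mulOp_one (symbol ξ)
    rw [h4] at h5
    filter_upwards [h5, Lp.coeFn_zero ℂ 2 μ, Lp.coeFn_zero ℂ ∞ μ] with x h6 h7 h8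
    rw [← h6, h7, h8]
  rw [← ofLinf_symbol ξ, h3, ofLinf_symbol]

/-- The `L^∞`-valued inner product `⟪η, ξ⟫ = L(η* ξ)`. -/
def transferInner (h : BoundedComposition μ φ) (η ξ : LInf μ) : LInf μ :=
  transferOp h (star η * ξ)

lemma coe_transferInner (h : BoundedComposition μ φ) (η ξ : LInf μ) :
    (transferInner h η ξ : BL2 μ) = star (η * polarS h : BL2 μ) * (ξ * polarS h) := by
  rw [transferInner, coe_transferOp, star_mul]
  change star (polarS h) * (star (η : BL2 μ) * ξ) * polarS h = _
  simp only [mul_assoc]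

lemma transferInner_mul_alpha (h : BoundedComposition μ φ) (a η ξ : LInf μ) :
    transferInner h η (ξ * alpha h a) = a * transferInner h η ξ := by
  refine Subtype.ext ?_
  change (transferInner h η (ξ * alpha h a) : BL2 μ) = a * (transferInner h η ξ : BL2 μ)
  rw [LInf_coe_mul_comm, coe_transferInner, coe_transferInner]
  change _ * (((ξ : BL2 μ) * alpha h a) * polarS h) = _
  rw [mul_assoc (ξ : BL2 μ), ← polarS_mem h a]
  simp only [mul_assoc]

lemma star_transferInner (h : BoundedComposition μ φ) (η ξ : LInf μ) :
    star (transferInner h η ξ) = transferInner h ξ η := by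
  refine Subtype.ext ?_
  change star (transferInner h η ξ : BL2 μ) = _
  rw [coe_transferInner, coe_transferInner, star_mul, star_star]

lemma transferInner_self_eq_zero {h : BoundedComposition μ φ} (hb : BoundedBelow (compOp h))
    {ξ : LInf μ} (h0 : transferInner h ξ ξ = 0) : ξ = 0 := by
  have h1 := congrArg (Subtype.val : LInf μ → BL2 μ) h0
  rw [coe_transferInner] at h1
  exact eq_zero_of_mul_polarS hb ((CStarRing.star_mul_self_eq_zero_iff _).mp h1)

lemma transferInner_add (h : BoundedComposition μ φ) (η ξ ζ : LInf μ) :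
    transferInner h η (ξ + ζ) = transferInner h η ξ + transferInner h η ζ := by
  rw [transferInner, mul_add, map_add]
  rfl

lemma transferInner_smul (h : BoundedComposition μ φ) (z : ℂ) (η ξ : LInf μ) :
    transferInner h η (z • ξ) = z • transferInner h η ξ := by
  rw [transferInner, mul_smul_comm, map_smul]
  rfl

lemma transferInner_zero (h : BoundedComposition μ φ) (η : LInf μ) :
    transferInner h η 0 = 0 := by
  rw [transferInner, mul_zero, map_zero]

lemma transferInner_self_nonneg (h : BoundedComposition μ φ) (ξ : LInf μ) :
    0 ≤ transferInner h ξ ξ := by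
  change (0 : BL2 μ) ≤ (transferInner h ξ ξ : BL2 μ)
  rw [coe_transferInner]
  exact star_mul_self_nonneg _

/-- `L^∞(X, μ)_L` is a Hilbert module over `L^∞` with inner product `⟪η, ξ⟫ = L(η* ξ)`. -/
instance instCStarModuleTransfer : CStarModule (LInf μ) (TransferModule h hb) where
  inner η ξ := transferInner h (ofTransfer h hb η) (ofTransfer h hb ξ)
  inner_add_right {η ξ ζ} :=
    transferInner_add h (ofTransfer h hb η) (ofTransfer h hb ξ) (ofTransfer h hb ζ)
  inner_self_nonneg {ξ} := transferInner_self_nonneg h (ofTransfer h hb ξ)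
  inner_self {ξ} := by
    constructor
    · exact fun h0 => transferInner_self_eq_zero hb h0
    · rintro rfl
      exact transferInner_zero h _
  inner_op_smul_right {a η ξ} :=
    transferInner_mul_alpha h a (ofTransfer h hb η) (ofTransfer h hb ξ)
  inner_smul_right_complex {z η ξ} :=
    transferInner_smul h z (ofTransfer h hb η) (ofTransfer h hb ξ)
  star_inner η ξ := star_transferInner h (ofTransfer h hb η) (ofTransfer h hb ξ)
  norm_eq_sqrt_norm_inner_self _ := rfl

lemma inner_transfer (η ξ : TransferModule h hb) :
    inner (LInf μ) η ξ = transferInner h (ofTransfer h hb η) (ofTransfer h hb ξ) := rfl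

end Composition

end CuntzModule

end

namespace CuntzModule

section OrthonormalBases

variable {X : Type*} [MeasurableSpace X] {μ : Measure X} [IsFiniteMeasure μ]

/-! All three conditions turn into statements about the operators `S_i = ξ_i S_φ` inside `B(L²)`.
The map `ξ ↦ ξ S_φ` is an injective inner-product-preserving module map from `L^∞(X, μ)_L` into the
intertwining module: `(η S_φ)* (ξ S_φ) = S_φ* η* ξ S_φ` is the transfer inner product, and `α(a) S_φ
= S_φ a` matches the two right actions (`coe_inner_toTransfer`, `transferToOp_smul`). Hence
orthonormality means `S_i* S_j = δ_ij` in every case.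

With `P = ∑ S_i S_i*`, the reconstruction formula for an element with operator `T` reads `T = P T`
(`eq_sum_transfer_iff`, `eq_sum_intertwining_iff`). If `P = 1`, this is automatic in both modules.
The converse is the main point, `eq_zero_of_forall_mul_polarS`: the operators `a S_φ` with `a ∈ L^∞`
already detect `P = 1`. If `(1 - P) a S_φ = 0` for all `a`, then `(1 - P) a C_φ = 0` because `C_φ =
S_φ |C_φ|`. Since `C_φ` fixes the constant function `1`, evaluating there gives `(1 - P) a 1 = 0`,
so `1 - P` vanishes on the dense subspace `L^∞ ⊆ L²`.

Finally, `∑ S_i S_i* = 1` forces the family to implement `α`: multiply by `α(a)` on the left and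
move it through each intertwiner `S_i`. Both basis conditions and the Cuntz condition therefore
coincide. -/

/-! ### Density: which vectors determine an operator -/

/-- The constant function `1` is cyclic for `L^∞`: an operator vanishing on `L^∞ ⊆ L²` is zero. -/
lemma eq_zero_of_forall_apply_LInf {P : BL2 μ}
    (hP : ∀ a : LInf μ, P ((a : BL2 μ) (Lp.const 2 μ 1)) = 0) : P = 0 := by
  ext1 ξ
  -- Simple functions are dense in `L²`, so indicators suffice. Each one is its own `L^∞`
  -- multiplication operator applied to `1`.
  refine Lp.induction ENNReal.ofNat_ne_top (fun ξ : Lp ℂ 2 μ => P ξ = 0) ?_ ?_ ?_ ξ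
  · intro c s hs hμs
    have hind : mulOp (indicatorConstLp ∞ hs (measure_ne_top μ s) c) (Lp.const 2 μ 1)
        = indicatorConstLp 2 hs (measure_ne_top μ s) c := by
      refine Lp.ext ?_
      filter_upwards [coeFn_mulOp_one (indicatorConstLp ∞ hs (measure_ne_top μ s) c),
        indicatorConstLp_coeFn (p := ∞) (hs := hs) (hμs := measure_ne_top μ s) (c := c),
        indicatorConstLp_coeFn (p := 2) (hs := hs) (hμs := measure_ne_top μ s) (c := c)]
        with x h1 h2 h3
      rw [h1, h2, h3]
    rw [Lp.simpleFunc.coe_indicatorConst, ← hind]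
    exact hP (ofLinf _)
  · intro f g hf hg _ h1 h2
    simp only [map_add, h1, h2, add_zero]
  · exact isClosed_eq P.continuous continuous_const

variable {φ : X → X} {h : BoundedComposition μ φ}

/-- The vectors `a S_φ ζ` with `a ∈ L^∞` and `ζ ∈ L²` span a dense subspace of `L²`. -/
lemma eq_zero_of_forall_mul_polarS (hb : BoundedBelow (compOp h)) {P : BL2 μ}
    (hP : ∀ a : LInf μ, P * (a * polarS h) = 0) : P = 0 := by
  refine eq_zero_of_forall_apply_LInf fun a => ?_
  have h1 : P * (a * compOp h) = 0 := by
    -- `C_φ` is `S_φ` times an operator on the right, so annihilation passes from `a S_φ` to `a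
    -- C_φ`. The gain is that `C_φ 1 = 1` is explicit, unlike `S_φ 1`.
    rw [← hb.polarPart_mul_polarAbs, ← mul_assoc (a : BL2 μ), ← mul_assoc P, hP a, zero_mul]
  have h2 := congrArg (fun R : BL2 μ => R (Lp.const 2 μ 1)) h1
  simpa only [mul_apply_eq_comp, compOp_one, zero_apply] using h2

/-! ### The embedding of the transfer module into the operators -/

lemma mul_polarS_injective (hb : BoundedBelow (compOp h)) :
    Function.Injective fun a : LInf μ => (a : BL2 μ) * polarS h := by
  intro a b hab
  refine sub_eq_zero.mp (eq_zero_of_mul_polarS hb ?_)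
  change ((a : BL2 μ) - b) * polarS h = 0
  rw [sub_mul, sub_eq_zero]
  exact hab

variable (h) in
/-- The embedding `ξ ↦ ξ S_φ` of `L^∞(X, μ)_L` into the bounded operators. -/
noncomputable def transferToOp (hb : BoundedBelow (compOp h)) : TransferModule h hb →+ BL2 μ where
  toFun a := (ofTransfer h hb a : BL2 μ) * polarS h
  map_zero' := zero_mul _
  map_add' a b := add_mul (ofTransfer h hb a : BL2 μ) (ofTransfer h hb b) (polarS h)

lemma transferToOp_toTransfer (hb : BoundedBelow (compOp h)) (a : LInf μ) :
    transferToOp h hb (toTransfer h hb a) = a * polarS h := rfl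

lemma transferToOp_injective (hb : BoundedBelow (compOp h)) :
    Function.Injective (transferToOp h hb) :=
  fun _ _ hab => (ofTransfer h hb).injective (mul_polarS_injective hb hab)

/-- The intertwining relation `α(a) S_φ = S_φ a` turns the twisted action on `L^∞` into plain right
multiplication of operators. -/
lemma transferToOp_smul (hb : BoundedBelow (compOp h)) (a ξ : LInf μ) :
    transferToOp h hb (a • toTransfer h hb ξ) = (ξ * polarS h) * a := by
  rw [smul_transfer, transferToOp_toTransfer, LinearEquiv.symm_apply_apply]
  change ((ξ : BL2 μ) * alpha h a) * polarS h = _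
  rw [mul_assoc, ← polarS_mem h, mul_assoc]

lemma coe_inner_toTransfer (hb : BoundedBelow (compOp h)) (η ξ : LInf μ) :
    ((inner (LInf μ) (toTransfer h hb η) (toTransfer h hb ξ) : LInf μ) : BL2 μ)
      = star (η * polarS h : BL2 μ) * (ξ * polarS h) :=
  coe_transferInner h η ξ

variable {n : ℕ}

/-- Carries the orthonormality relations from `L^∞` to `B(L²)`, where the Cuntz relations live. -/
lemma coe_eq_ite_iff {a : LInf μ} {p : Prop} [Decidable p] :
    a = (if p then 1 else 0) ↔ (a : BL2 μ) = if p then 1 else 0 := by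
  rw [Subtype.ext_iff]
  split_ifs <;> rfl

/-! ### Reconstruction formulas and implementation of the endomorphism -/

/-- The reconstruction formula in `L^∞(X, μ)_L`, as an identity of operators. -/
lemma eq_sum_transfer_iff (hb : BoundedBelow (compOp h)) (ξ : Fin n → LInf μ) (a : LInf μ) :
    toTransfer h hb a
        = ∑ i, inner (LInf μ) (toTransfer h hb (ξ i)) (toTransfer h hb a) •
          toTransfer h hb (ξ i) ↔
      (a : BL2 μ) * polarS h
        = (∑ i, (ξ i * polarS h) * star (ξ i * polarS h : BL2 μ)) * (a * polarS h) := by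
  -- Injectivity of the embedding is what allows the operator identity to be pulled back to the
  -- module.
  rw [← (transferToOp_injective hb).eq_iff, map_sum, Finset.sum_mul, transferToOp_toTransfer]
  refine Eq.congr_right (Finset.sum_congr rfl fun i _ => ?_)
  rw [transferToOp_smul, coe_inner_toTransfer, mul_assoc (_ * _) (star _)]

/-- The reconstruction formula in the intertwining module, as an identity of operators. -/
lemma eq_sum_intertwining_iff {α : LInf μ →⋆ₐ[ℂ] LInf μ} (S : Fin n → intertwiningModule α)
    (T : intertwiningModule α) :
    T = ∑ i, inner (LInf μ) (S i) T • S i ↔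
      (T : BL2 μ) = (∑ i, (S i : BL2 μ) * star (S i : BL2 μ)) * T := by
  rw [Subtype.ext_iff, AddSubmonoidClass.coe_finsetSum, Finset.sum_mul]
  refine Eq.congr_right (Finset.sum_congr rfl fun i _ => ?_)
  rw [coe_smul_intertwining, coe_inner_intertwining, mul_assoc]

/-- A finite family of intertwiners whose range projections add up to `1` implements `α`. -/
lemma implements_of_sum_mul_star_eq_one {α : LInf μ →⋆ₐ[ℂ] LInf μ} {S : Fin n → BL2 μ}
    (hS : ∀ i, S i ∈ intertwiningModule α) (h1 : ∑ i, S i * star (S i) = 1) :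
    Implements S α := by
  intro a
  calc (α a : BL2 μ) = α a * ∑ i, S i * star (S i) := by rw [h1, mul_one]
    _ = ∑ i, S i * a * star (S i) := by
      rw [Finset.mul_sum]
      -- Termwise, `α(a) S_i = S_i a`.
      exact Finset.sum_congr rfl fun i _ => by rw [hS i a, mul_assoc]

/-! ### Orthonormal bases as Cuntz families -/

/-- `ξ` is an orthonormal basis of `L^∞(X, μ)_L` iff the operators `ξ i S_φ` form a Cuntz
family. -/
lemma isOrthonormalModuleBasis_transfer_iff (hb : BoundedBelow (compOp h))
    (ξ : Fin n → LInf μ) :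
    IsOrthonormalModuleBasis (LInf μ) (fun i => toTransfer h hb (ξ i)) ↔
      IsCuntzFamily fun i => (ξ i : BL2 μ) * polarS h := by
  refine and_congr ?_ ?_
  · refine forall₂_congr fun i j => ?_
    rw [coe_eq_ite_iff, coe_inner_toTransfer]
  · constructor
    · intro H
      -- Reconstruction of every `a` says that `1 - ∑ S_i S_i*` kills every `a S_φ`, hence is zero.
      refine (sub_eq_zero.mp (eq_zero_of_forall_mul_polarS hb fun a => ?_)).symm
      rw [sub_mul, one_mul, sub_eq_zero]
      exact (eq_sum_transfer_iff hb ξ a).mp (H _)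
    · intro H a
      obtain ⟨a, rfl⟩ := (toTransfer h hb).surjective a
      rw [eq_sum_transfer_iff, H, one_mul]

/-- The operators `ξ i S_φ` are an orthonormal basis of the intertwining module iff they form a
Cuntz family. -/
lemma isOrthonormalModuleBasis_mulPolarS_iff (hb : BoundedBelow (compOp h))
    (ξ : Fin n → LInf μ) :
    IsOrthonormalModuleBasis (LInf μ) (fun i => mulPolarS h (ξ i)) ↔
      IsCuntzFamily fun i => (ξ i : BL2 μ) * polarS h := by
  refine and_congr ?_ ?_
  · refine forall₂_congr fun i j => ?_
    rw [coe_eq_ite_iff, coe_inner_intertwining]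
    rfl
  · constructor
    · intro H
      refine (sub_eq_zero.mp (eq_zero_of_forall_mul_polarS hb fun a => ?_)).symm
      rw [sub_mul, one_mul, sub_eq_zero]
      -- Only the elements `a S_φ` of the intertwining module are tested; no description of its
      -- other elements is needed.
      exact (eq_sum_intertwining_iff _ (mulPolarS h a)).mp (H _)
    · intro H T
      rw [eq_sum_intertwining_iff]
      exact (by rw [H, one_mul] : (T : BL2 μ)
        = (∑ i, (ξ i * polarS h) * star (ξ i * polarS h : BL2 μ)) * T)

end OrthonormalBases

end CuntzModule

/-- On a compact Hausdorff space with a regular Borel probability measure `μ`, suppose that `μ` is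
`φ`-bounded and that `C_φ` is a bounded operator on `L²` that is bounded below. -/
theorem theorem5p2 {X : Type*} [TopologicalSpace X] [CompactSpace X] [T2Space X]
    [MeasurableSpace X] [BorelSpace X] (μ : MeasureTheory.Measure X)
    [MeasureTheory.IsProbabilityMeasure μ] [μ.Regular] (φ : X → X)
    (hμ : CuntzModule.IsPhiBounded μ φ) (hC : CuntzModule.BoundedComposition μ φ)
    (hb : CuntzModule.BoundedBelow (CuntzModule.compOp hC)) {n : ℕ}
    (ξ : Fin n → CuntzModule.LInf μ) :
    List.TFAE [
      CuntzModule.IsOrthonormalModuleBasis (CuntzModule.LInf μ)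
        (fun i => CuntzModule.toTransfer hC hb (ξ i)),
      CuntzModule.IsOrthonormalModuleBasis (CuntzModule.LInf μ)
        (fun i => CuntzModule.mulPolarS hC (ξ i)),
      CuntzModule.IsCuntzFamily
          (fun i => (ξ i : CuntzModule.BL2 μ) * CuntzModule.polarS hC) ∧
        CuntzModule.Implements
          (fun i => (ξ i : CuntzModule.BL2 μ) * CuntzModule.polarS hC) (CuntzModule.alpha hC)] := by
  -- Implementing `α` is redundant in the third condition, since every `ξ_i S_φ` is an intertwiner
  -- and the range projections sum to `1`.
  have hC3 : (CuntzModule.IsCuntzFamily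
          (fun i => (ξ i : CuntzModule.BL2 μ) * CuntzModule.polarS hC) ∧
        CuntzModule.Implements
          (fun i => (ξ i : CuntzModule.BL2 μ) * CuntzModule.polarS hC) (CuntzModule.alpha hC)) ↔
      CuntzModule.IsCuntzFamily
          (fun i => (ξ i : CuntzModule.BL2 μ) * CuntzModule.polarS hC) :=
    and_iff_left_of_imp fun H => CuntzModule.implements_of_sum_mul_star_eq_one
      (fun i => CuntzModule.LInf_mul_mem_intertwiningModule (CuntzModule.polarS_mem hC) (ξ i)) H.2
  rw [hC3, CuntzModule.isOrthonormalModuleBasis_transfer_iff hb,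
    CuntzModule.isOrthonormalModuleBasis_mulPolarS_iff hb]
  -- After the rewriting, all three entries are the same Cuntz condition.
  tfae_have 1 ↔ 2 := Iff.rfl
  tfae_have 2 ↔ 3 := Iff.rfl
  tfae_finish
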